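/- For a finite simple graph $G$ with vertex set $V$, let $S(G)$ be the set of real symmetric matrices $A=(a_{ij})_{i,j\in V}$ such that, for all $i\neq j$, $a_{ij}\neq 0$ if and only if $i$ and $j$ are adjacent in $G$ (the diagonal entries are unrestricted). Let $q(A)$ denote the number of distinct eigenvalues of $A$, and let $q(G)=\min\{q(A) : A\in S(G)\}$. Let $K_n$ be the complete graph on $n$ vertices, $P_m$ the path on $m$ vertices, and let $G\vee H$ be the join of $G$ and $H$, that is, the graph obtained from the disjoint union of $G$ and $H$ by adding all edges with one endpoint in $G$ and the other in $H$. Then, for all integers $m,n\geq 2$, \[ q(K_n\vee P_m)=\left\lceil \frac{n+m}{n+1}\right\rceil . \] -/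

import Mathlib

namespace SimpleGraph

/-- The join `G ∨ H`: the disjoint union of `G` and `H` together with all edges
having one endpoint in `G` and the other in `H`. -/
def joinGraph {V W : Type*} (G : SimpleGraph V) (H : SimpleGraph W) : SimpleGraph (V ⊕ W) :=
  (G ⊕g H) ⊔ completeBipartiteGraph V W

/-- `S(G)`: the real symmetric matrices, with rows and columns indexed by the vertices of `G`,
whose off-diagonal entry in position `(i, j)` is nonzero exactly when `i` and `j` are adjacent.
The diagonal is unrestricted. -/
def symmetricMatrices {V : Type*} (G : SimpleGraph V) : Set (Matrix V V ℝ) :=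
  {A | A.IsSymm ∧ ∀ i j, i ≠ j → (A i j ≠ 0 ↔ G.Adj i j)}

end SimpleGraph

/-- `q(A)`: the number of distinct eigenvalues of the square matrix `A`
(the spectrum of a matrix is a finite set). -/
noncomputable def Matrix.numDistinctEigenvalues {V : Type*} [Fintype V] [DecidableEq V]
    (A : Matrix V V ℝ) : ℕ :=
  (spectrum ℝ A).ncard

namespace SimpleGraph

/-- `q(G)`: the minimum of `q(A)` over all `A ∈ S(G)`. -/
noncomputable def minDistinctEigenvalues {V : Type*} [Fintype V] [DecidableEq V]
    (G : SimpleGraph V) : ℕ :=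
  sInf (Matrix.numDistinctEigenvalues '' G.symmetricMatrices)

/-- The infimum defining `q(G)` is attained, that is, it is a minimum. -/
theorem isLeast_minDistinctEigenvalues {V : Type*} [Fintype V] [DecidableEq V]
    (G : SimpleGraph V) :
    IsLeast (Matrix.numDistinctEigenvalues '' G.symmetricMatrices)
      G.minDistinctEigenvalues := by
  classical
  have hne : (Matrix.numDistinctEigenvalues '' G.symmetricMatrices).Nonempty :=
    ⟨_, G.adjMatrix ℝ, ⟨G.isSymm_adjMatrix, fun i j _ => by simp [adjMatrix_apply]⟩, rfl⟩
  exact ⟨Nat.sInf_mem hne, fun _ hk => Nat.sInf_le hk⟩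

end SimpleGraph

open scoped Matrix

/-! Lower bound: for an eigenvector vanishing on the clique and at the first path vertex, the
eigenvalue equation at each path vertex forces the next entry to vanish, so the vector is zero.
Every eigenspace thus has dimension at most n + 1, whence n + m ≤ q(A)(n + 1).

Upper bound: let d + 1 be the claimed value, so that m ≤ d + 1 + nd; a matrix with spectrum inside
{0, …, d} is wanted. The spectrum is arranged first, the graph afterwards. Each clique vertex
becomes the hub of an arrow matrix with at most d shaft entries θ, which interlace its prescribed
eigenvalues 0 and some of 1, …, d; partial fractions supply the couplings (`prod_sub_eq_arrow`,
`exists_arrow`). At most d + 1 further entries stay uncoupled and are eigenvalues themselves. This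
leaves room for m shaft entries, all distinct.

Conjugating by an orthogonal block matrix diag(Q, U) then creates the pattern. U makes diag(θ) a
Jacobi matrix, that is, a path (`exists_jacobi`), and Q, a Householder reflection, fills the clique
and join blocks (`exists_orthogonal_forall_ne_zero`). All the required nonvanishing is generic: each
condition is a polynomial one that holds at some point. -/

/-! ### Lower bound: eigenvalue multiplicities -/

open SimpleGraph in
theorem eigenvector_join_path_eq_zero {ι : Type*} [Fintype ι] {m : ℕ} {H : SimpleGraph ι}
    {A : Matrix (ι ⊕ Fin m) (ι ⊕ Fin m) ℝ}
    (hA : A ∈ (joinGraph H (pathGraph m)).symmetricMatrices) (hm : 0 < m)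
    {z : ℝ} {w : ι ⊕ Fin m → ℝ} (hw : A.mulVec w = z • w) (h0 : ∀ i, w (Sum.inl i) = 0)
    (h1 : w (Sum.inr ⟨0, hm⟩) = 0) : w = 0 := by
  have key : ∀ r (hr : r < m), w (Sum.inr ⟨r, hr⟩) = 0 := by
    intro r
    induction r using Nat.strong_induction_on with
    | _ r ih =>
      intro hr
      rcases r with _ | r
      · exact h1
      -- In row r only the entry at r + 1 survives: clique entries and earlier path entries vanish,
      -- and later path vertices are not adjacent to r.
      · have e := congrFun hw (Sum.inr ⟨r, by omega⟩)
        simp only [Matrix.mulVec, dotProduct, Fintype.sum_sum_type, h0, mul_zero,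
          Finset.sum_const_zero, zero_add, Pi.smul_apply, ih r (by omega) (by omega),
          smul_zero] at e
        rw [Finset.sum_eq_single (⟨r + 1, hr⟩ : Fin m)] at e
        · refine (mul_eq_zero.1 e).resolve_left ?_
          refine (hA.2 _ _ (by simp)).2 ?_
          simp [joinGraph, pathGraph_adj]
        · intro b _ hb
          have hb' : (b : ℕ) ≠ r + 1 := fun h => hb (Fin.ext h)
          rcases Nat.lt_or_ge b (r + 1) with h | h
          · rw [show b = ⟨b, b.2⟩ from rfl, ih b h b.2, mul_zero]
          · have : ¬ A (Sum.inr ⟨r, by omega⟩) (Sum.inr b) ≠ 0 := by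
              rw [hA.2 _ _ (by simp [Fin.ext_iff]; omega)]
              simp [joinGraph, pathGraph_adj]
              omega
            rw [not_not.1 this, zero_mul]
        · simp
  ext (i | i)
  · exact h0 i
  · exact key i i.2

open SimpleGraph in
theorem card_le_numDistinctEigenvalues_mul {ι : Type*} [Fintype ι] [DecidableEq ι] {m : ℕ}
    {H : SimpleGraph ι} {A : Matrix (ι ⊕ Fin m) (ι ⊕ Fin m) ℝ}
    (hA : A ∈ (joinGraph H (pathGraph m)).symmetricMatrices) (hm : 0 < m) :
    Fintype.card ι + m ≤ A.numDistinctEigenvalues * (Fintype.card ι + 1) := by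
  have hH : A.IsHermitian := by
    have := hA.1
    rwa [Matrix.IsHermitian, Matrix.conjTranspose_eq_transpose_of_trivial]
  have hfib : ∀ z ∈ Finset.univ.image hH.eigenvalues,
      (Finset.univ.filter fun i => hH.eigenvalues i = z).card ≤ Fintype.card ι + 1 := by
    intro z _
    -- Restriction to the clique and the first path vertex, which is injective on the eigenspace.
    let L : (ι ⊕ Fin m → ℝ) →ₗ[ℝ] (ι ⊕ Unit → ℝ) :=
      LinearMap.funLeft ℝ ℝ (Sum.map id fun _ => ⟨0, hm⟩)
    let S : Submodule ℝ (ι ⊕ Fin m → ℝ) := Module.End.eigenspace (Matrix.toLin' A) z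
    have hS : Module.finrank ℝ S ≤ Fintype.card ι + 1 := by
      have hinj : Function.Injective (L.domRestrict S) := by
        rw [← LinearMap.ker_eq_bot, LinearMap.ker_eq_bot']
        rintro ⟨w, hw⟩ h
        have hw' : A.mulVec w = z • w := by
          simpa [S, Module.End.mem_eigenspace_iff] using hw
        have h' : ∀ a, w (Sum.map id (fun _ => ⟨0, hm⟩) a) = 0 := fun a => congrFun h a
        exact Subtype.ext (eigenvector_join_path_eq_zero hA hm hw' (fun i => h' (Sum.inl i))
          (h' (Sum.inr ())))
      simpa using LinearMap.finrank_le_finrank_of_injective hinj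
    refine le_trans ?_ hS
    have hli : LinearIndependent ℝ (fun i : {i // hH.eigenvalues i = z} =>
        (⟨(hH.eigenvectorBasis i).ofLp, by
          have := hH.mulVec_eigenvectorBasis i
          rw [i.2] at this
          simpa [S, Module.End.mem_eigenspace_iff] using this⟩ : S)) := by
      apply LinearIndependent.of_comp S.subtype
      have h1 := hH.eigenvectorBasis.orthonormal.linearIndependent
      have h2 := h1.map' (WithLp.linearEquiv 2 ℝ (ι ⊕ Fin m → ℝ)).toLinearMap
        (LinearEquiv.ker _)
      exact h2.comp (fun i : {i // hH.eigenvalues i = z} => i.1) Subtype.val_injective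
    have := hli.fintype_card_le_finrank
    rwa [Fintype.card_subtype] at this
  have hcard := Finset.card_le_mul_card_image (f := hH.eigenvalues) Finset.univ _ hfib
  rw [Matrix.numDistinctEigenvalues, hH.spectrum_real_eq_range_eigenvalues]
  have : (Set.range hH.eigenvalues).ncard = (Finset.univ.image hH.eigenvalues).card := by
    rw [← Set.ncard_coe_finset]; simp
  rw [this, mul_comm]
  simpa using hcard

/-! ### Genericity and Householder reflections -/

/-- Real polynomials form a domain, so the product is nonzero, and a nonzero polynomial over an
infinite field is not the zero function. Each condition may therefore be tested at its own point. -/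
theorem MvPolynomial.exists_forall_eval_ne_zero {κ σ : Type*} [Finite κ]
    (P : κ → MvPolynomial σ ℝ) (h : ∀ a, ∃ x, MvPolynomial.eval x (P a) ≠ 0) :
    ∃ x, ∀ a, MvPolynomial.eval x (P a) ≠ 0 := by
  have := Fintype.ofFinite κ
  have hP : ∏ a, P a ≠ 0 := Finset.prod_ne_zero_iff.2 fun a _ h0 => by
    obtain ⟨x, hx⟩ := h a
    simp [h0] at hx
  by_contra! hx
  refine hP (MvPolynomial.funext fun x => ?_)
  obtain ⟨a, ha⟩ := hx x
  rw [map_prod, map_zero]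
  exact Finset.prod_eq_zero (Finset.mem_univ a) ha

/-- A generic Householder reflection makes all off-diagonal entries of a non-scalar diagonal
matrix nonzero, and all entries of a matrix with nonzero rows. -/
theorem exists_orthogonal_forall_ne_zero {ι ρ : Type*} [Fintype ι] [DecidableEq ι] [Finite ρ]
    (c : ι → ℝ) (hc : ∃ i j, c i ≠ c j) (B : Matrix ρ ι ℝ) (hB : ∀ r, B r ≠ 0) :
    ∃ Q : Matrix ι ι ℝ, Q * Qᵀ = 1 ∧ Qᵀ * Q = 1 ∧
      (∀ i j, i ≠ j → (Q * Matrix.diagonal c * Qᵀ) i j ≠ 0) ∧ ∀ r i, (B * Qᵀ) r i ≠ 0 := by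
  classical
  obtain ⟨p, q, hpq⟩ := hc
  have hpq' : p ≠ q := fun h => hpq (h ▸ rfl)
  let N : MvPolynomial ι ℝ := ∑ l, MvPolynomial.X l ^ 2
  -- Up to powers of N = |y|² and constants, these are the entries of Q diag(c) Qᵀ and B Qᵀ for Q =
  -- 1 - 2yyᵀ/|y|².
  let P : Unit ⊕ {t : ι × ι // t.1 ≠ t.2} ⊕ ρ × ι → MvPolynomial ι ℝ :=
    Sum.elim (fun _ => N) (Sum.elim
      (fun t => MvPolynomial.X t.1.1 * MvPolynomial.X t.1.2 *
        ∑ l, MvPolynomial.C (2 * c l - c t.1.1 - c t.1.2) * MvPolynomial.X l ^ 2)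
      (fun t => MvPolynomial.C (B t.1 t.2) * N -
        2 * (∑ l, MvPolynomial.C (B t.1 l) * MvPolynomial.X l) * MvPolynomial.X t.2))
  obtain ⟨y, hy⟩ := MvPolynomial.exists_forall_eval_ne_zero P (by
    rintro (_ | ⟨⟨i, j⟩, hij⟩ | ⟨r, i⟩)
    · refine ⟨Pi.single p 1, ?_⟩
      simp [P, N, Pi.single_apply]
    · simp only at hij
      by_cases hcij : c i = c j
      · obtain ⟨l, hl⟩ : ∃ l, c l ≠ c i := by
          by_contra! h
          exact hpq ((h p).trans (h q).symm)
        have hli : l ≠ i := fun h => hl (h ▸ rfl)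
        have hlj : l ≠ j := fun h => hl (h ▸ hcij.symm)
        refine ⟨fun t => if t = i ∨ t = j ∨ t = l then 1 else 0, ?_⟩
        have : ∀ t, (2 * c t - c i - c j) * (if t = i ∨ t = j ∨ t = l then (1 : ℝ) else 0) ^ 2
            = if t = l then 2 * c l - c i - c j else 0 := by
          intro t
          by_cases h1 : t = i
          · subst h1; simp [hli.symm, hcij]; ring
          by_cases h2 : t = j
          · subst h2; simp [hlj.symm, hcij]; ring
          by_cases h3 : t = l
          · subst h3; simp
          · simp [h1, h2, h3]
        simp only [P, Sum.elim_inr, Sum.elim_inl, map_mul, map_sum, map_pow,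
          MvPolynomial.eval_X, MvPolynomial.eval_C, this]
        simp
        intro h
        apply hl; linarith
      -- Unequal weights are needed: with equal ones the contributions of i and j cancel.
      · refine ⟨Pi.single i 1 + Pi.single j 2, ?_⟩
        have : ∀ t, (2 * c t - c i - c j) *
            ((Pi.single i 1 + Pi.single j 2 : ι → ℝ) t) ^ 2
            = (if t = i then c i - c j else 0) + (if t = j then 4 * (c j - c i) else 0) := by
          intro t
          by_cases h1 : t = i
          · subst h1; simp [hij]; ring
          by_cases h2 : t = j
          · subst h2; simp [hij.symm]; ring
          · simp [h1, h2]
        simp only [P, Sum.elim_inr, Sum.elim_inl, map_mul, map_sum, map_pow,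
          MvPolynomial.eval_X, MvPolynomial.eval_C, this]
        simp [Finset.sum_add_distrib, hij, hij.symm]
        intro h
        apply hcij; linarith
    · by_cases hri : B r i = 0
      · obtain ⟨l, hl⟩ := Function.ne_iff.1 (hB r)
        simp only [Pi.zero_apply] at hl
        have hli : l ≠ i := fun h => hl (h ▸ hri)
        refine ⟨Pi.single i 1 + Pi.single l 1, ?_⟩
        simp [P, N, hri, mul_add, Finset.sum_add_distrib, Pi.single_apply, hl, hli.symm]
      · obtain ⟨l, hl⟩ : ∃ l, l ≠ i := by
          by_cases h : p = i
          · exact ⟨q, fun h' => hpq' (h.trans h'.symm)⟩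
          · exact ⟨p, h⟩
        refine ⟨Pi.single l 1, ?_⟩
        simp [P, N, hri, Pi.single_apply, hl.symm])
  have hN : (∑ l, y l ^ 2) ≠ 0 := by simpa [P, N] using hy (Sum.inl ())
  have h1 : ∀ i j, i ≠ j → y i * y j * ∑ l, (2 * c l - c i - c j) * y l ^ 2 ≠ 0 := by
    intro i j hij
    have := hy (Sum.inr (Sum.inl ⟨(i, j), hij⟩))
    simpa only [P, Sum.elim_inr, Sum.elim_inl, map_mul, map_sum, map_pow,
      MvPolynomial.eval_X, MvPolynomial.eval_C] using this
  have h2 : ∀ r i, B r i * (∑ l, y l ^ 2) - 2 * (∑ l, B r l * y l) * y i ≠ 0 := by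
    intro r i
    have := hy (Sum.inr (Sum.inr (r, i)))
    simpa only [P, N, Sum.elim_inr, map_mul, map_sum, map_pow, map_sub, map_ofNat,
      MvPolynomial.eval_X, MvPolynomial.eval_C] using this
  set s := ∑ l, y l ^ 2 with hs
  clear_value s
  let Q : Matrix ι ι ℝ := 1 - (2 / s) • Matrix.vecMulVec y y
  have hQT : Qᵀ = Q := by
    ext i j
    simp [Q, Matrix.vecMulVec_apply, Matrix.one_apply, eq_comm, mul_comm]
  have hvv : Matrix.vecMulVec y y * Matrix.vecMulVec y y = s • Matrix.vecMulVec y y := by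
    ext i j
    simp only [Matrix.mul_apply, Matrix.vecMulVec_apply, Matrix.smul_apply, smul_eq_mul, hs,
      Finset.sum_mul]
    exact Finset.sum_congr rfl fun l _ => by ring
  have hQQ : Q * Q = 1 := by
    simp only [Q, sub_mul, mul_sub, one_mul, mul_one, Matrix.smul_mul, Matrix.mul_smul, hvv,
      smul_smul]
    rw [show 2 / s * (2 / s * s) = 2 / s + 2 / s by field_simp; norm_num, add_smul]
    abel
  refine ⟨Q, by rw [hQT, hQQ], by rw [hQT, hQQ], ?_, ?_⟩
  · intro i j hij
    rw [hQT]
    have : (Q * Matrix.diagonal c * Q) i j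
        = (2 / s ^ 2) * (y i * y j * ∑ l, (2 * c l - c i - c j) * y l ^ 2) := by
      have e1 : ∑ l, (2 * c l - c i - c j) * y l ^ 2
          = 2 * ∑ l, c l * y l ^ 2 - (c i + c j) * s := by
        rw [hs, Finset.mul_sum, Finset.mul_sum, ← Finset.sum_sub_distrib]
        exact Finset.sum_congr rfl fun l _ => by ring
      have e2 : (Matrix.vecMulVec y y * Matrix.diagonal c * Matrix.vecMulVec y y) i j
          = y i * y j * ∑ l, c l * y l ^ 2 := by
        simp only [Matrix.mul_apply (M := Matrix.vecMulVec y y * Matrix.diagonal c),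
          Matrix.mul_diagonal, Matrix.vecMulVec_apply, Finset.mul_sum]
        exact Finset.sum_congr rfl fun l _ => by ring
      have e3 : (Matrix.diagonal c) i j = 0 := Matrix.diagonal_apply_ne _ hij
      rw [e1]
      simp only [Q, sub_mul, mul_sub, one_mul, mul_one, Matrix.smul_mul, Matrix.mul_smul,
        Matrix.sub_apply, Matrix.smul_apply, e2, e3, Matrix.mul_diagonal, Matrix.diagonal_mul,
        Matrix.vecMulVec_apply, smul_eq_mul]
      field_simp
      ring
    rw [this]
    exact mul_ne_zero (by positivity) (h1 i j hij)
  · intro r i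
    rw [hQT]
    have : (B * Q) r i = (1 / s) * (B r i * s - 2 * (∑ l, B r l * y l) * y i) := by
      have e : (B * Matrix.vecMulVec y y) r i = (∑ l, B r l * y l) * y i := by
        simp only [Matrix.mul_apply, Matrix.vecMulVec_apply, Finset.sum_mul]
        exact Finset.sum_congr rfl fun l _ => by ring
      simp only [Q, Matrix.mul_sub, Matrix.mul_one, Matrix.mul_smul, Matrix.sub_apply, Matrix.smul_apply, e,
        smul_eq_mul]
      field_simp
    rw [this]
    exact mul_ne_zero (by positivity) (h2 r i)

/-! ### Jacobi matrices from Krylov vectors -/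

/-- Gram-type matrix whose kernel consists of the coefficient vectors of the polynomials `p` of
degree at most `r` such that `p(D) x` is orthogonal to `x, D x, …, D ^ (r - 1) x` and to `v`,
where `D` is the diagonal matrix with entries `θ`. -/
def krylovMatrix {J R : Type*} [Fintype J] [CommRing R] (θ v x : J → R) (r : ℕ) :
    Matrix (Fin (r + 1)) (Fin (r + 1)) R :=
  Matrix.of fun t c => if (t : ℕ) < r then ∑ s, θ s ^ (t + c : ℕ) * x s ^ 2
    else ∑ s, v s * θ s ^ (c : ℕ) * x s

/-- It suffices to find one good x, supported on r + 1 nodes. There, orthogonality to all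
polynomials of degree below r leaves a single degree of freedom: the weights p(θ s) x(s)² are
proportional to the divided-difference weights 1/ω(s). The condition involving v then kills the
constant of proportionality κ. -/
theorem exists_det_krylovMatrix_ne_zero {J : Type*} [Fintype J] [DecidableEq J] {θ v : J → ℝ}
    (hθ : Function.Injective θ) (hv : v ≠ 0) {r : ℕ} (hr : r < Fintype.card J) :
    ∃ x, (krylovMatrix θ v x r).det ≠ 0 := by
  obtain ⟨s₀, hs₀⟩ := Function.ne_iff.1 hv
  simp only [Pi.zero_apply] at hs₀
  obtain ⟨S, hS₀, -, hS⟩ := Finset.exists_subsuperset_card_eq (n := r + 1)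
    (Finset.subset_univ {s₀}) (by simp) (by simpa using hr)
  rw [Finset.singleton_subset_iff] at hS₀
  let ω : J → ℝ := fun s => ∏ t ∈ S.erase s, (θ s - θ t)
  have hω : ∀ s, ω s ≠ 0 := fun s => Finset.prod_ne_zero_iff.2 fun t ht =>
    sub_ne_zero.2 fun h => (Finset.ne_of_mem_erase ht) (hθ h).symm
  -- The choice x = v ω makes the terms v / (x ω) equal to 1/ω² wherever v is nonzero, so their sum
  -- is positive.
  let x : J → ℝ := fun s => if s ∈ S then (if v s = 0 then 1 else v s * ω s) else 0
  have hx : ∀ s ∈ S, x s ≠ 0 := by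
    intro s hs
    by_cases h : v s = 0
    · simp [x, hs, h]
    · simp [x, hs, h, hω s]
  have hx0 : ∀ s ∉ S, x s = 0 := fun s hs => by simp [x, hs]
  refine ⟨x, fun hdet => ?_⟩
  obtain ⟨a, ha, hMa⟩ := Matrix.exists_mulVec_eq_zero_iff.2 hdet
  let p : Polynomial ℝ := ∑ c : Fin (r + 1), Polynomial.C (a c) * Polynomial.X ^ (c : ℕ)
  have hp : ∀ z, p.eval z = ∑ c : Fin (r + 1), a c * z ^ (c : ℕ) := by
    intro z
    simp [p, Polynomial.eval_finsetSum]
  have hpdeg : p.degree < (r + 1 : ℕ) := by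
    refine (Polynomial.degree_sum_le _ _).trans_lt ((Finset.sup_lt_iff ?_).2 fun c _ => ?_)
    · exact WithBot.bot_lt_coe _
    · exact (Polynomial.degree_C_mul_X_pow_le _ _).trans_lt (by exact_mod_cast c.2)
  have hmom : ∀ t < r, ∑ s ∈ S, θ s ^ t * (p.eval (θ s) * x s ^ 2) = 0 := by
    intro t ht
    have := congrFun hMa ⟨t, by omega⟩
    simp only [Matrix.mulVec, dotProduct, krylovMatrix, Matrix.of_apply, ht, if_true,
      Pi.zero_apply, Finset.sum_mul] at this
    rw [Finset.sum_comm] at this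
    rw [Finset.sum_subset (Finset.subset_univ S) (fun s _ hs => by simp [hx0 s hs]), ← this]
    refine Finset.sum_congr rfl fun s _ => ?_
    rw [hp, Finset.sum_mul, Finset.mul_sum]
    exact Finset.sum_congr rfl fun c _ => by ring
  have hlast : ∑ s ∈ S, v s * x s * p.eval (θ s) = 0 := by
    have := congrFun hMa (Fin.last r)
    simp only [Matrix.mulVec, dotProduct, krylovMatrix, Matrix.of_apply, Fin.val_last,
      lt_irrefl, if_false, Pi.zero_apply, Finset.sum_mul] at this
    rw [Finset.sum_comm] at this
    rw [Finset.sum_subset (Finset.subset_univ S) (fun s _ hs => by simp [hx0 s hs]), ← this]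
    refine Finset.sum_congr rfl fun s _ => ?_
    rw [hp, Finset.mul_sum]
    exact Finset.sum_congr rfl fun c _ => by ring
  have htest : ∀ q : Polynomial ℝ, q.natDegree < r →
      ∑ s ∈ S, q.eval (θ s) * (p.eval (θ s) * x s ^ 2) = 0 := by
    intro q hq
    simp_rw [Polynomial.eval_eq_sum_range' hq, Finset.sum_mul]
    rw [Finset.sum_comm]
    refine Finset.sum_eq_zero fun t ht => ?_
    rw [← mul_zero (q.coeff t), ← hmom t (Finset.mem_range.1 ht), Finset.mul_sum]
    exact Finset.sum_congr rfl fun c _ => by ring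
  let κ := p.eval (θ s₀) * x s₀ ^ 2 * ω s₀
  have hκ : ∀ s ∈ S, p.eval (θ s) * x s ^ 2 * ω s = κ := by
    intro s hs
    by_cases hss : s = s₀
    · rw [hss]
    -- Vanishing at all nodes but s and s₀, this test polynomial of degree r - 1 compares the two
    -- remaining weights.
    let q : Polynomial ℝ :=
      ∏ t ∈ (S.erase s).erase s₀, (Polynomial.X - Polynomial.C (θ t))
    have hqe : ∀ z, q.eval z = ∏ t ∈ (S.erase s).erase s₀, (z - θ t) := by
      intro z
      simp [q, Polynomial.eval_prod]
    have hs₀' : s₀ ∈ S.erase s := Finset.mem_erase.2 ⟨Ne.symm hss, hS₀⟩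
    have hs' : s ∈ S.erase s₀ := Finset.mem_erase.2 ⟨hss, hs⟩
    have h2 : 0 < (S.erase s).card := Finset.card_pos.2 ⟨_, hs₀'⟩
    have hq : q.natDegree < r := by
      rw [Polynomial.natDegree_prod_of_monic _ _ fun t _ => Polynomial.monic_X_sub_C _]
      simp only [Polynomial.natDegree_X_sub_C, Finset.sum_const, smul_eq_mul, mul_one]
      rw [Finset.card_erase_of_mem hs] at h2
      rw [Finset.card_erase_of_mem hs₀', Finset.card_erase_of_mem hs]
      omega
    have h := htest q hq
    rw [← Finset.add_sum_erase _ _ hs, ← Finset.add_sum_erase _ _ hs₀',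
      Finset.sum_eq_zero (s := (S.erase s).erase s₀), add_zero] at h
    · have e1 : ω s = (θ s - θ s₀) * q.eval (θ s) := by
        rw [hqe]
        exact (Finset.mul_prod_erase _ _ hs₀').symm
      have e2 : ω s₀ = (θ s₀ - θ s) * q.eval (θ s₀) := by
        rw [hqe, Finset.erase_right_comm]
        exact (Finset.mul_prod_erase _ _ hs').symm
      simp only [κ, e1, e2]
      linear_combination (θ s - θ s₀) * h
    · intro t ht
      rw [hqe, Finset.prod_eq_zero ht (sub_self _), zero_mul]
  have hκ0 : κ = 0 := by
    have hterm : ∀ s ∈ S, v s * x s * p.eval (θ s) = κ * (v s / (x s * ω s)) := by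
      intro s hs
      have := hx s hs
      have := hω s
      rw [← hκ s hs]
      field_simp
    rw [Finset.sum_congr rfl hterm, ← Finset.mul_sum] at hlast
    refine (mul_eq_zero.1 hlast).resolve_right (ne_of_gt ?_)
    have hval : ∀ s ∈ S, v s / (x s * ω s) = if v s = 0 then 0 else 1 / ω s ^ 2 := by
      intro s hs
      by_cases h : v s = 0
      · simp [h]
      · have := hω s
        simp only [x, hs, h, if_true, if_false]
        field_simp
    rw [Finset.sum_congr rfl hval]
    refine Finset.sum_pos' (fun s _ => ?_) ⟨s₀, hS₀, ?_⟩
    · split_ifs <;> positivity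
    · have := hω s₀
      rw [if_neg hs₀]
      positivity
  have hp0 : p = 0 := by
    refine Polynomial.eq_zero_of_degree_lt_of_eval_index_eq_zero S (v := θ) hθ.injOn
      (by rwa [hS]) fun s hs => ?_
    have h := hκ s hs
    rw [hκ0] at h
    have h1 := hx s hs
    have h2 := hω s
    simpa [h1, h2] using h
  apply ha
  ext c
  have : p.coeff c = a c := by
    simp only [p, Polynomial.finsetSum_coeff, Polynomial.coeff_C_mul_X_pow, Fin.val_inj]
    simp
  rw [← this, hp0]
  simp

theorem exists_forall_det_krylovMatrix_ne_zero {J : Type*} [Fintype J] [DecidableEq J]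
    {θ v : J → ℝ} (hθ : Function.Injective θ) (hv : v ≠ 0) :
    ∃ x : J → ℝ, (∀ s, x s ≠ 0) ∧
      ∀ r < Fintype.card J, (krylovMatrix θ v x r).det ≠ 0 := by
  let P : J ⊕ Fin (Fintype.card J) → MvPolynomial J ℝ :=
    Sum.elim MvPolynomial.X fun r => (krylovMatrix (fun s => MvPolynomial.C (θ s))
      (fun s => MvPolynomial.C (v s)) MvPolynomial.X r).det
  have hP : ∀ x r, MvPolynomial.eval x (P (Sum.inr r)) = (krylovMatrix θ v x r).det := by
    intro x r
    simp only [P, Sum.elim_inr]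
    rw [RingHom.map_det]
    congr 1
    ext t c
    simp only [krylovMatrix, RingHom.mapMatrix_apply, Matrix.map_apply, Matrix.of_apply]
    split_ifs <;> simp
  obtain ⟨x, hx⟩ := MvPolynomial.exists_forall_eval_ne_zero P (by
    rintro (s | r)
    · exact ⟨1, by simp [P]⟩
    · obtain ⟨x, hx⟩ := exists_det_krylovMatrix_ne_zero hθ hv r.2
      exact ⟨x, by rwa [hP]⟩)
  refine ⟨x, fun s => by simpa [P] using hx (Sum.inl s), fun r hr => ?_⟩
  rw [← hP x ⟨r, hr⟩]
  exact hx _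

/-- A Jacobi matrix with prescribed simple spectrum `θ`, such that in the coordinates in which it
is tridiagonal a given nonzero vector `v` has no zero entry. -/
theorem exists_jacobi {J : Type*} [Fintype J] [DecidableEq J] {m : ℕ}
    (hJ : Fintype.card J = m) {θ v : J → ℝ} (hθ : Function.Injective θ) (hv : v ≠ 0) :
    ∃ U : Matrix (Fin m) J ℝ, U * Uᵀ = 1 ∧ Uᵀ * U = 1 ∧
      (∀ r t, r ≠ t → ((U * Matrix.diagonal θ * Uᵀ) r t ≠ 0 ↔
        (SimpleGraph.pathGraph m).Adj r t)) ∧ ∀ r, (U *ᵥ v) r ≠ 0 := by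
  obtain ⟨x, hx, hdet⟩ := exists_forall_det_krylovMatrix_ne_zero hθ hv
  let g : ℕ → EuclideanSpace ℝ J := fun c => WithLp.toLp 2 fun s => θ s ^ c * x s
  let f : Fin m → EuclideanSpace ℝ J := fun r => g r
  let D : EuclideanSpace ℝ J →ₗ[ℝ] EuclideanSpace ℝ J := Matrix.toEuclideanLin (Matrix.diagonal θ)
  have hD : ∀ (y : EuclideanSpace ℝ J) s, D y s = θ s * y s := fun y s => by
    simp [D, Matrix.toLpLin_apply, Matrix.mulVec_diagonal]
  have hDg : ∀ c, D (g c) = g (c + 1) := by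
    intro c
    ext s
    rw [hD]
    simp only [g]
    ring
  have hin : ∀ y y' : EuclideanSpace ℝ J, inner ℝ y y' = ∑ s, y s * y' s := by
    intro y y'
    simp [PiLp.inner_apply, mul_comm]
  have hDsymm : ∀ y y' : EuclideanSpace ℝ J, inner ℝ (D y) y' = inner ℝ y (D y') := by
    intro y y'
    simp only [hin, hD]
    exact Finset.sum_congr rfl fun s _ => by ring
  have hf : LinearIndependent ℝ f := by
    rw [Fintype.linearIndependent_iff]
    intro a ha
    let e : Fin m ≃ J := (Fintype.equivFinOfCardEq hJ).symm
    have hdet' : (Matrix.vandermonde fun i => θ (e i)).det ≠ 0 :=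
      Matrix.det_vandermonde_ne_zero_iff.2 (hθ.comp e.injective)
    have : a = 0 := by
      by_contra h
      refine hdet' (Matrix.exists_mulVec_eq_zero_iff.1 ⟨a, h, ?_⟩)
      ext i
      have h1 : (∑ c, a c • f c : EuclideanSpace ℝ J) (e i) = 0 := by rw [ha]; rfl
      simp only [f, g, WithLp.ofLp_sum, WithLp.ofLp_smul, Finset.sum_apply, Pi.smul_apply,
        smul_eq_mul] at h1
      refine (mul_eq_zero.1 (?_ : _ * x (e i) = 0)).resolve_right (hx _)
      rw [← h1]
      simp only [Matrix.mulVec, dotProduct, Matrix.vandermonde_apply, Finset.sum_mul]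
      exact Finset.sum_congr rfl fun c _ => by ring
    exact fun i => congrFun this i
  -- Lanczos: D maps the span of the first Krylov vectors into the next span, so D is tridiagonal in
  -- the orthonormalised Krylov basis.
  let e : Fin m → EuclideanSpace ℝ J := InnerProductSpace.gramSchmidtNormed ℝ f
  have he : Orthonormal ℝ e := InnerProductSpace.gramSchmidtNormed_orthonormal hf
  have hspan : ∀ r, Submodule.span ℝ (e '' Set.Iic r) = Submodule.span ℝ (f '' Set.Iic r) := by
    intro r
    rw [InnerProductSpace.span_gramSchmidtNormed, InnerProductSpace.span_gramSchmidt_Iic]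
  have hemem : ∀ r, e r ∈ Submodule.span ℝ (f '' Set.Iic r) := fun r =>
    hspan r ▸ Submodule.subset_span ⟨r, Set.mem_Iic.2 le_rfl, rfl⟩
  have horth : ∀ r t, t < r → ∀ y ∈ Submodule.span ℝ (f '' Set.Iic t),
      inner ℝ (e r) y = 0 := by
    intro r t htr y hy
    rw [← hspan] at hy
    induction hy using Submodule.span_induction with
    | mem y hy =>
      obtain ⟨j, hj, rfl⟩ := hy
      exact he.2 (ne_of_gt (lt_of_le_of_lt hj htr))
    | zero => simp
    | add y y' _ _ h h' => rw [inner_add_right, h, h', add_zero]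
    | smul a y _ h => rw [inner_smul_right, h, mul_zero]
  have hfmem : ∀ r t, r ≤ t → f r ∈ Submodule.span ℝ (f '' Set.Iic t) := fun r t h =>
    Submodule.subset_span ⟨r, h, rfl⟩
  have hfar : ∀ r t : Fin m, (t : ℕ) + 1 < r → inner ℝ (e r) (D (e t)) = 0 := by
    intro r t htr
    let t' : Fin m := ⟨t + 1, by omega⟩
    refine horth r t' htr _ ?_
    have : Submodule.span ℝ (f '' Set.Iic t) ≤
        (Submodule.span ℝ (f '' Set.Iic t')).comap D := by
      rw [Submodule.span_le]
      rintro _ ⟨j, hj, rfl⟩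
      have hj' : (j : ℕ) ≤ t := hj
      refine Submodule.mem_comap.2 ?_
      rw [show D (f j) = f ⟨j + 1, by omega⟩ from hDg j]
      exact hfmem _ _ (by simp only [Fin.le_def, t']; omega)
    exact this (hemem t)
  have hnext : ∀ r t : Fin m, (t : ℕ) + 1 = r → inner ℝ (e r) (D (e t)) ≠ 0 := by
    intro r t htr h0
    have h1 : ∀ y ∈ Submodule.span ℝ (e '' Set.Iic t), inner ℝ (e r) (D y) = 0 := by
      intro y hy
      induction hy using Submodule.span_induction with
      | mem y hy =>
        obtain ⟨j, hj, rfl⟩ := hy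
        rcases eq_or_lt_of_le (Set.mem_Iic.1 hj) with h | h
        · rw [h, h0]
        · exact hfar _ _ (by have := Fin.lt_def.1 h; omega)
      | zero => simp
      | add y y' _ _ h h' => rw [map_add, inner_add_right, h, h', add_zero]
      | smul a y _ h => rw [map_smul, inner_smul_right, h, mul_zero]
    -- Since f r = D (f t), a zero subdiagonal entry would make e r orthogonal to its own span,
    -- hence to itself.
    have h2 : inner ℝ (e r) (f r) = 0 := by
      have : f r = D (f t) := by
        simp only [f, hDg, htr]
      rw [this]
      exact h1 _ (hspan t ▸ hfmem t t le_rfl)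
    have h3 : ∀ y ∈ Submodule.span ℝ (f '' Set.Iic r), inner ℝ (e r) y = 0 := by
      intro y hy
      induction hy using Submodule.span_induction with
      | mem y hy =>
        obtain ⟨j, hj, rfl⟩ := hy
        rcases eq_or_lt_of_le (Set.mem_Iic.1 hj) with h | h
        · rw [h, h2]
        · exact horth r j h _ (hfmem j j le_rfl)
      | zero => simp
      | add y y' _ _ h h' => rw [inner_add_right, h, h', add_zero]
      | smul a y _ h => rw [inner_smul_right, h, mul_zero]
    have h4 := h3 _ (hemem r)
    rw [real_inner_self_eq_norm_sq, he.1 r] at h4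
    norm_num at h4
  have hve : ∀ r, inner ℝ (e r) (WithLp.toLp 2 v) ≠ 0 := by
    intro r h0
    -- The coefficients of e r in the Krylov vectors would be a nonzero kernel vector of
    -- `krylovMatrix`.
    refine hdet r (hJ ▸ r.2) (Matrix.exists_mulVec_eq_zero_iff.1 ?_)
    have hmem : e r ∈ Submodule.span ℝ (Set.range fun c : Fin ((r : ℕ) + 1) => g c) := by
      refine Submodule.span_mono ?_ (hemem r)
      rintro _ ⟨j, hj, rfl⟩
      have hj' : (j : ℕ) ≤ r := hj
      exact ⟨⟨j, by omega⟩, rfl⟩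
    obtain ⟨a, ha⟩ := (Submodule.mem_span_range_iff_exists_fun ℝ).1 hmem
    have hea : ∀ s, e r s = ∑ c : Fin ((r : ℕ) + 1), a c * (θ s ^ (c : ℕ) * x s) := by
      intro s
      rw [← ha]
      simp [g]
    refine ⟨a, ?_, ?_⟩
    · rintro rfl
      refine he.ne_zero r ?_
      rw [← ha]
      simp
    · ext t
      simp only [Matrix.mulVec, dotProduct, krylovMatrix, Matrix.of_apply, Pi.zero_apply]
      by_cases ht : (t : ℕ) < r
      · have h1 := horth r ⟨t, by omega⟩ ht _ (hfmem ⟨t, by omega⟩ _ le_rfl)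
        rw [← h1, hin]
        simp only [ht, if_true, Finset.sum_mul]
        rw [Finset.sum_comm]
        refine Finset.sum_congr rfl fun s _ => ?_
        rw [hea, Finset.sum_mul]
        refine Finset.sum_congr rfl fun c _ => ?_
        simp only [f, g]
        ring
      · rw [← h0, hin]
        simp only [ht, if_false, Finset.sum_mul]
        rw [Finset.sum_comm]
        refine Finset.sum_congr rfl fun s _ => ?_
        rw [hea, Finset.sum_mul]
        exact Finset.sum_congr rfl fun c _ => by ring
  let U : Matrix (Fin m) J ℝ := Matrix.of fun r s => e r s
  have hUU : U * Uᵀ = 1 := by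
    ext r t
    rw [Matrix.mul_apply, Matrix.one_apply, ← orthonormal_iff_ite.1 he r t, hin]
    rfl
  have hUD : ∀ r t, (U * Matrix.diagonal θ * Uᵀ) r t = inner ℝ (e r) (D (e t)) := by
    intro r t
    rw [Matrix.mul_apply, hin]
    refine Finset.sum_congr rfl fun s _ => ?_
    rw [hD, Matrix.mul_diagonal]
    simp only [U, Matrix.transpose_apply, Matrix.of_apply]
    ring
  refine ⟨U, hUU, ?_, ?_, ?_⟩
  · exact (Matrix.mul_eq_one_comm_of_card_eq (Fin m) J ℝ (by simp [hJ])).1 hUU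
  · intro r t hrt
    have hrt' : (r : ℕ) ≠ t := fun h => hrt (Fin.ext h)
    have hcomm : inner ℝ (e r) (D (e t)) = inner ℝ (e t) (D (e r)) := by
      rw [← hDsymm, real_inner_comm]
    rw [hUD, SimpleGraph.pathGraph_adj]
    constructor
    · intro h
      by_contra! hne
      rcases Nat.lt_or_ge t r with h' | h'
      · exact h (hfar r t (by omega))
      · exact h (hcomm.trans (hfar t r (by omega)))
    · rintro (h | h)
      · rw [hcomm]; exact hnext t r h
      · exact hnext r t h
  · intro r
    have : (U *ᵥ v) r = inner ℝ (e r) (WithLp.toLp 2 v) := by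
      rw [hin]; rfl
    rw [this]
    exact hve r

/-! ### Arrow matrices with prescribed eigenvalues -/

-- Both products are monic of degree `s.card + 1`, and the shift of a equalises their root sums, so
-- the two leading coefficients cancel.
open Polynomial in
theorem degree_arrow_sub_lt {J : Type*} [DecidableEq J] (s : Finset J) (lam θ : J → ℝ) (a : ℝ) :
    ((X - C a) * ∏ j ∈ s, (X - C (lam j)) -
      (X - C (a + ∑ j ∈ s, (lam j - θ j))) * ∏ j ∈ s, (X - C (θ j))).degree
        < (s.card : WithBot ℕ) := by
  induction s using Finset.induction_on with
  | empty => simp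
  | insert i s hi ih =>
    rw [Finset.prod_insert hi, Finset.prod_insert hi, Finset.sum_insert hi,
      Finset.card_insert_of_notMem hi]
    set c := a + ∑ j ∈ s, (lam j - θ j) with hc
    have hc' : a + (lam i - θ i + ∑ j ∈ s, (lam j - θ j)) = c + lam i - θ i := by
      rw [hc]; ring
    rw [hc']
    set P := ∏ j ∈ s, (X - C (lam j))
    set Q := ∏ j ∈ s, (X - C (θ j)) with hQ
    have hQdeg : Q.degree ≤ s.card := by
      rw [hQ, degree_prod]; simp
    have e : (X - C a) * ((X - C (lam i)) * P) - (X - C (c + lam i - θ i)) * ((X - C (θ i)) * Q)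
        = ((X - C a) * P - (X - C c) * Q) * (X - C (lam i)) +
          C (c * lam i - (c + lam i - θ i) * θ i) * Q := by
      simp only [map_add, map_sub, map_mul]
      ring
    rw [e]
    refine (degree_add_le _ _).trans_lt (max_lt ?_ ?_)
    · rw [degree_mul, degree_X_sub_C]
      push_cast
      exact WithBot.add_lt_add_right (by simp) ih
    · refine (degree_mul_le _ _).trans_lt ?_
      refine (add_le_add degree_C_le hQdeg).trans_lt ?_
      rw [zero_add]
      exact_mod_cast Nat.lt_succ_self _

/-- Partial fractions for the characteristic polynomial of an arrow matrix. -/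
theorem prod_sub_eq_arrow {J : Type*} [DecidableEq J] (s : Finset J) (lam θ : J → ℝ)
    (hθ : Set.InjOn θ s) (a z : ℝ) (hz : ∀ j ∈ s, z ≠ θ j) :
    (z - a) * ∏ j ∈ s, (z - lam j) =
      (z - (a + ∑ j ∈ s, (lam j - θ j)) -
        ∑ j ∈ s, -((θ j - a) * ∏ i ∈ s, (θ j - lam i)) / (∏ i ∈ s.erase j, (θ j - θ i)) /
          (z - θ j)) * ∏ j ∈ s, (z - θ j) := by
  open Polynomial in
  let β : J → ℝ := fun j => (θ j - a) * (∏ i ∈ s, (θ j - lam i)) / ∏ i ∈ s.erase j, (θ j - θ i)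
  let F : ℝ[X] := (X - C a) * ∏ j ∈ s, (X - C (lam j)) -
      (X - C (a + ∑ j ∈ s, (lam j - θ j))) * ∏ j ∈ s, (X - C (θ j))
  let G : ℝ[X] := ∑ j ∈ s, C (β j) * ∏ i ∈ s.erase j, (X - C (θ i))
  have hG : G.degree < s.card := by
    refine (degree_sum_le _ _).trans_lt ((Finset.sup_lt_iff (WithBot.bot_lt_coe _)).2
      fun j hj => ?_)
    refine (degree_mul_le _ _).trans_lt ?_
    rw [degree_prod]
    simp only [degree_X_sub_C, Finset.sum_const, nsmul_eq_mul, mul_one]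
    refine (add_le_add_left degree_C_le _).trans_lt ?_
    rw [zero_add]
    exact_mod_cast Finset.card_erase_lt_of_mem hj
  have hFG : F - G = 0 := by
    refine eq_zero_of_degree_lt_of_eval_index_eq_zero s (v := θ) hθ
      ((degree_sub_le _ _).trans_lt (max_lt (degree_arrow_sub_lt s lam θ a) hG)) fun j hj => ?_
    have h1 : G.eval (θ j) = β j * ∏ i ∈ s.erase j, (θ j - θ i) := by
      simp only [G, eval_finsetSum, eval_mul, eval_C, eval_prod, eval_sub, eval_X]
      refine Finset.sum_eq_single_of_mem j hj fun i hi hij => ?_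
      rw [Finset.prod_eq_zero (Finset.mem_erase.2 ⟨hij.symm, hj⟩) (sub_self _), mul_zero]
    have h2 : ∏ i ∈ s.erase j, (θ j - θ i) ≠ 0 := Finset.prod_ne_zero_iff.2 fun i hi =>
      sub_ne_zero.2 fun h => Finset.ne_of_mem_erase hi
        (hθ (Finset.mem_of_mem_erase hi) hj h.symm)
    have h3 : ∏ i ∈ s, (θ j - θ i) = 0 := Finset.prod_eq_zero hj (sub_self _)
    rw [eval_sub, h1]
    simp only [F, eval_mul, eval_C, eval_prod, eval_sub, eval_X, h3, β]
    field_simp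
    ring
  have h := congrArg (eval z) hFG
  simp only [F, G, eval_mul, eval_C, eval_prod, eval_sub, eval_X, eval_finsetSum,
    eval_zero] at h
  have hsum : (∑ j ∈ s, -((θ j - a) * ∏ i ∈ s, (θ j - lam i)) /
      (∏ i ∈ s.erase j, (θ j - θ i)) / (z - θ j)) * ∏ j ∈ s, (z - θ j)
      = - ∑ j ∈ s, β j * ∏ i ∈ s.erase j, (z - θ i) := by
    rw [Finset.sum_mul, ← Finset.sum_neg_distrib]
    refine Finset.sum_congr rfl fun j hj => ?_
    have := sub_ne_zero.2 (hz j hj)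
    rw [← Finset.mul_prod_erase s (fun i => z - θ i) hj]
    simp only [β]
    field_simp
  rw [sub_mul (z - (a + ∑ j ∈ s, (lam j - θ j))), hsum]
  linear_combination h

/-- A direct sum of arrow matrices, with shaft entries `θ`, whose eigenvalues are `0` and the
prescribed numbers `lam`. -/
theorem exists_arrow {ι J : Type*} [Fintype ι] [DecidableEq ι] [Fintype J] [DecidableEq J]
    (o : J → Option ι) (lam θ : J → ℝ) (hθ : Function.Injective θ)
    (hnone : ∀ s, o s = none → θ s = lam s) (hpos : ∀ s, o s ≠ none → 0 < θ s ∧ θ s < lam s)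
    (hint : ∀ s t, o s ≠ none → o s = o t → s ≠ t → 0 < (θ s - lam t) * (θ s - θ t)) :
    ∃ b : J → ℝ, (∀ s, o s ≠ none → b s ≠ 0) ∧
      ∀ B : Matrix J ι ℝ, (B = Matrix.of fun s i => if o s = some i then b s else 0) →
      ∀ (z : ℝ) (w : ι ⊕ J → ℝ), w ≠ 0 →
        (Matrix.fromBlocks (Matrix.diagonal fun i => ∑ s with o s = some i, (lam s - θ s)) Bᵀ B
          (Matrix.diagonal θ)) *ᵥ w = z • w → z = 0 ∨ ∃ s, z = lam s := by
  let N : Option ι → Finset J := fun i => Finset.univ.filter fun s => o s = i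
  -- Squared couplings, read off as partial-fraction residues; interlacing makes them positive, so
  -- real square roots serve as b.
  let β : J → ℝ := fun s => -((θ s - 0) * ∏ t ∈ N (o s), (θ s - lam t)) /
    ∏ t ∈ (N (o s)).erase s, (θ s - θ t)
  have hβ : ∀ s, o s ≠ none → 0 < β s := by
    intro s hs
    have hmem : s ∈ N (o s) := by simp [N]
    have e : β s = θ s * (lam s - θ s) *
        ∏ t ∈ (N (o s)).erase s, (θ s - lam t) / (θ s - θ t) := by
      simp only [β, Finset.prod_div_distrib]
      rw [← Finset.mul_prod_erase _ _ hmem]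
      ring
    rw [e]
    obtain ⟨h1, h2⟩ := hpos s hs
    refine mul_pos (mul_pos h1 (sub_pos.2 h2)) (Finset.prod_pos fun t ht => ?_)
    have ht' : o t = o s := by simpa [N] using Finset.mem_of_mem_erase ht
    have h := hint s t hs ht'.symm (Finset.ne_of_mem_erase ht).symm
    rcases mul_pos_iff.1 h with ⟨h3, h4⟩ | ⟨h3, h4⟩
    · exact div_pos h3 h4
    · exact div_pos_of_neg_of_neg h3 h4
  refine ⟨fun s => Real.sqrt (β s), fun s hs => (Real.sqrt_pos.2 (hβ s hs)).ne', ?_⟩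
  rintro B rfl z w hw hzw
  by_contra! hz
  obtain ⟨hz0, hz⟩ := hz
  have hJ : ∀ s, (∑ i, (if o s = some i then Real.sqrt (β s) else 0) * w (Sum.inl i))
      + θ s * w (Sum.inr s) = z * w (Sum.inr s) := by
    intro s
    have := congrFun hzw (Sum.inr s)
    simp only [Matrix.fromBlocks_mulVec, Sum.elim_inr, Pi.add_apply,
      Matrix.mulVec_diagonal] at this
    simpa [ Matrix.mulVec, dotProduct] using this
  have hJ' : ∀ i, ∀ s ∈ N (some i),
      Real.sqrt (β s) * w (Sum.inl i) = (z - θ s) * w (Sum.inr s) := by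
    intro i s hs
    have hos : o s = some i := by simpa [N] using hs
    have := hJ s
    simp only [hos, Option.some.injEq, ite_mul, zero_mul, Finset.sum_ite_eq, Finset.mem_univ,
      if_true] at this
    linear_combination this
  have hι : ∀ i, (∑ s ∈ N (some i), (lam s - θ s)) * w (Sum.inl i)
      + ∑ s ∈ N (some i), Real.sqrt (β s) * w (Sum.inr s) = z * w (Sum.inl i) := by
    intro i
    have := congrFun hzw (Sum.inl i)
    simp only [Matrix.fromBlocks_mulVec, Sum.elim_inl, Pi.add_apply,
      Matrix.mulVec_diagonal] at this
    simpa [ Matrix.mulVec, dotProduct, N, Finset.sum_filter] using this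
  have hnone' : ∀ s, o s = none → w (Sum.inr s) = 0 := by
    intro s hs
    have h := hJ s
    simp only [hs, reduceCtorEq, if_false, zero_mul, Finset.sum_const_zero, zero_add,
      hnone s hs] at h
    have : (z - lam s) * w (Sum.inr s) = 0 := by linear_combination -h
    exact (mul_eq_zero.1 this).resolve_left (sub_ne_zero.2 (hz s))
  have hinl : ∀ i, w (Sum.inl i) = 0 := by
    intro i
    by_cases h : ∃ s ∈ N (some i), z = θ s
    · obtain ⟨s, hs, hzs⟩ := h
      have h := hJ' i s hs
      rw [hzs, sub_self, zero_mul] at h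
      have hos : o s = some i := by simpa [N] using hs
      exact (mul_eq_zero.1 h).resolve_left (Real.sqrt_pos.2 (hβ s (by simp [hos]))).ne'
    · push Not at h
      have hw2 : ∀ s ∈ N (some i), Real.sqrt (β s) * w (Sum.inr s) =
          (β s / (z - θ s)) * w (Sum.inl i) := by
        intro s hs
        have hos : o s = some i := by simpa [N] using hs
        have h1 := sub_ne_zero.2 (h s hs)
        have h2 := hJ' i s hs
        have h3 := Real.sq_sqrt (hβ s (by simp [hos])).le
        rw [div_mul_eq_mul_div, eq_div_iff h1]
        linear_combination (-Real.sqrt (β s)) * h2 + w (Sum.inl i) * h3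
      have h1 := hι i
      rw [Finset.sum_congr rfl hw2, ← Finset.sum_mul] at h1
      -- Eliminating the shaft leaves a scalar Schur complement at the hub, nonzero because z is
      -- neither 0 nor any lam.
      have key := prod_sub_eq_arrow (N (some i)) lam θ hθ.injOn 0 z h
      have hβ' : ∑ s ∈ N (some i), β s / (z - θ s) = ∑ j ∈ N (some i),
          -((θ j - 0) * ∏ i ∈ N (some i), (θ j - lam i)) /
            (∏ i ∈ (N (some i)).erase j, (θ j - θ i)) / (z - θ j) := by
        refine Finset.sum_congr rfl fun s hs => ?_
        have hos : o s = some i := by simpa [N] using hs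
        simp only [β, hos]
      rw [← hβ'] at key
      have hne : (z - 0) * ∏ j ∈ N (some i), (z - lam j) ≠ 0 :=
        mul_ne_zero (by simpa using hz0)
          (Finset.prod_ne_zero_iff.2 fun s _ => sub_ne_zero.2 (hz s))
      rw [key] at hne
      refine (mul_eq_zero.1 ?_).resolve_left (left_ne_zero_of_mul hne)
      linear_combination -h1
  apply hw
  ext (i | s)
  · exact hinl i
  rcases hos : o s with _ | i
  · exact hnone' s hos
  have hs : s ∈ N (some i) := by simp [N, hos]
  by_cases hzs : z = θ s
  · have h1 := hι i
    rw [hinl i, mul_zero, mul_zero, zero_add, Finset.sum_eq_single_of_mem s hs] at h1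
    · have : Real.sqrt (β s) ≠ 0 := (Real.sqrt_pos.2 (hβ s (by simp [hos]))).ne'
      simpa [this] using h1
    · intro t ht hts
      have h2 := hJ' i t ht
      rw [hinl i, mul_zero, hzs] at h2
      have : w (Sum.inr t) = 0 := (mul_eq_zero.1 h2.symm).resolve_left
        (sub_ne_zero.2 fun h => hts (hθ h).symm)
      rw [this, mul_zero]
  · have h2 := hJ' i s hs
    rw [hinl i, mul_zero] at h2
    exact (mul_eq_zero.1 h2.symm).resolve_left (sub_ne_zero.2 hzs)

/-! ### Assembly and the choice of parameters -/

open SimpleGraph in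
theorem exists_mem_symmetricMatrices_of_arrow {ι J : Type*} [Fintype ι] [DecidableEq ι]
    [Fintype J] [DecidableEq J] {m : ℕ} (hJ : Fintype.card J = m)
    (o : J → Option ι) (lam θ : J → ℝ) (hθ : Function.Injective θ)
    (hnone : ∀ s, o s = none → θ s = lam s) (hpos : ∀ s, o s ≠ none → 0 < θ s ∧ θ s < lam s)
    (hint : ∀ s t, o s ≠ none → o s = o t → s ≠ t → 0 < (θ s - lam t) * (θ s - θ t))
    (hsome : ∃ s, o s ≠ none)
    (hc : ∃ i j, (∑ s with o s = some i, (lam s - θ s)) ≠ ∑ s with o s = some j, (lam s - θ s)) :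
    ∃ A ∈ (joinGraph (completeGraph ι) (pathGraph m)).symmetricMatrices,
      ∀ z ∈ spectrum ℝ A, z = 0 ∨ ∃ s, z = lam s := by
  obtain ⟨b, hb, hspec⟩ := exists_arrow o lam θ hθ hnone hpos hint
  obtain ⟨s₀, hs₀⟩ := hsome
  obtain ⟨i₀, hi₀⟩ := Option.ne_none_iff_exists'.1 hs₀
  let B : Matrix J ι ℝ := Matrix.of fun s i => if o s = some i then b s else 0
  let C : Matrix ι ι ℝ := Matrix.diagonal fun i => ∑ s with o s = some i, (lam s - θ s)
  -- One nonzero column of B suffices: it keeps every row of U B nonzero, and Q then spreads this to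
  -- all columns.
  obtain ⟨U, hU1, hU2, hUT, hUv⟩ := exists_jacobi hJ hθ (v := fun s => B s i₀) (by
    refine Function.ne_iff.2 ⟨s₀, ?_⟩
    simpa [B, hi₀] using hb s₀ hs₀)
  obtain ⟨Q, hQ1, hQ2, hQC, hQB⟩ := exists_orthogonal_forall_ne_zero _ hc (U * B)
    fun r h => hUv r (congrFun h i₀)
  let M := Matrix.fromBlocks C Bᵀ B (Matrix.diagonal θ)
  let W : Matrix (ι ⊕ Fin m) (ι ⊕ J) ℝ := Matrix.fromBlocks Q 0 0 U
  have hW1 : W * Wᵀ = 1 := by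
    simp [W, Matrix.fromBlocks_transpose, Matrix.fromBlocks_multiply, hQ1, hU1]
  have hW2 : Wᵀ * W = 1 := by
    simp [W, Matrix.fromBlocks_transpose, Matrix.fromBlocks_multiply, hQ2, hU2]
  have hA : W * M * Wᵀ = Matrix.fromBlocks (Q * C * Qᵀ) (U * B * Qᵀ)ᵀ (U * B * Qᵀ)
      (U * Matrix.diagonal θ * Uᵀ) := by
    simp [W, M, Matrix.fromBlocks_transpose, Matrix.fromBlocks_multiply, Matrix.mul_assoc]
  have hM : Mᵀ = M := by
    simp [M, C, Matrix.fromBlocks_transpose]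
  refine ⟨W * M * Wᵀ, ⟨?_, ?_⟩, ?_⟩
  · rw [Matrix.IsSymm, Matrix.transpose_mul, Matrix.transpose_mul, hM, Matrix.transpose_transpose,
      Matrix.mul_assoc]
  · rw [hA]
    rintro (i | r) (j | t) hij
    · have hij' : i ≠ j := fun h => hij (h ▸ rfl)
      exact iff_of_true (hQC i j hij') (by simp [joinGraph, hij'])
    · exact iff_of_true (hQB t i) (by simp [joinGraph])
    · exact iff_of_true (hQB r j) (by simp [joinGraph])
    · have hrt : r ≠ t := fun h => hij (h ▸ rfl)
      simpa [joinGraph] using hUT r t hrt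
  · intro z hz
    rw [← Matrix.spectrum_toLin', ← Module.End.hasEigenvalue_iff_mem_spectrum] at hz
    obtain ⟨w, hw⟩ := hz.exists_hasEigenvector
    have hw1 : (W * M * Wᵀ) *ᵥ w = z • w := by
      simpa only [Matrix.toLin'_apply] using hw.apply_eq_smul
    refine hspec B rfl z (Wᵀ *ᵥ w) (fun h => hw.2 ?_) ?_
    · rw [← Matrix.one_mulVec w, ← hW1, ← Matrix.mulVec_mulVec, h, Matrix.mulVec_zero]
    · calc M *ᵥ (Wᵀ *ᵥ w) = ((Wᵀ * W) * (M * Wᵀ)) *ᵥ w := by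
            rw [hW2, Matrix.one_mul, Matrix.mulVec_mulVec]
        _ = Wᵀ *ᵥ ((W * M * Wᵀ) *ᵥ w) := by
            rw [Matrix.mulVec_mulVec]; simp only [Matrix.mul_assoc]
        _ = z • (Wᵀ *ᵥ w) := by rw [hw1, Matrix.mulVec_smul]

open SimpleGraph in
theorem exists_numDistinctEigenvalues_join_path_le {m n d : ℕ} (hm : 1 ≤ m) (hn : 2 ≤ n)
    (hd : 1 ≤ d) (hmd : m ≤ d + 1 + n * d) :
    ∃ A ∈ (joinGraph (completeGraph (Fin n)) (pathGraph m)).symmetricMatrices,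
      A.numDistinctEigenvalues ≤ d + 1 := by
  let X := Fin (d + 1) ⊕ Fin n × Fin d
  let i₀ : Fin n := ⟨0, by omega⟩
  let i₁ : Fin n := ⟨1, by omega⟩
  obtain ⟨T, hT₀, -, hT⟩ := Finset.exists_subsuperset_card_eq (n := m)
    (Finset.subset_univ ({Sum.inr (i₀, ⟨0, hd⟩)} : Finset X)) (by simpa using hm)
    (by simpa [X] using hmd)
  rw [Finset.singleton_subset_iff] at hT₀
  -- Distinct offsets in (0, 1) put each θ strictly between consecutive integers and keep all θ
  -- distinct. They decrease fast enough that hub i₀, with at least one shaft entry, has diagonal at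
  -- least 1/2, while hub i₁, with at most d, stays at or below d/(2d + 4) < 1/2; so the hub block
  -- is not scalar.
  let δ : Fin n → ℝ := fun i => 1 / (2 * (d + 1) * (i : ℕ) + 2)
  have hδ0 : ∀ i, 0 < δ i := fun i => by simp only [δ]; positivity
  have hδ1 : ∀ i, δ i < 1 := fun i => by
    simp only [δ]
    rw [div_lt_one (by positivity)]
    have : (0 : ℝ) ≤ 2 * (d + 1) * (i : ℕ) := by positivity
    linarith
  have hδ : Function.Injective δ := by
    intro i j h
    simp only [δ, one_div, inv_inj, add_left_inj] at h
    have := mul_left_cancel₀ (by positivity : (2 * ((d : ℝ) + 1)) ≠ 0) h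
    exact Fin.ext (by exact_mod_cast this)
  let o : X → Option (Fin n) := Sum.elim (fun _ => none) fun p => some p.1
  let lam : X → ℝ := Sum.elim (fun l => (l : ℕ)) fun p => (p.2 : ℕ) + 1
  let θ : X → ℝ := Sum.elim (fun l => (l : ℕ)) fun p => (p.2 : ℕ) + 1 - δ p.1
  have hnat : ∀ (a b : ℕ) (x y : ℝ), 0 ≤ x → x < 1 → 0 ≤ y → y < 1 →
      (a : ℝ) + 1 - x = b + 1 - y → a = b := by
    intro a b x y hx0 hx1 hy0 hy1 h
    have h1 : (a : ℝ) < b + 1 := by linarith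
    have h2 : (b : ℝ) < a + 1 := by linarith
    have h1' : a < b + 1 := by exact_mod_cast h1
    have h2' : b < a + 1 := by exact_mod_cast h2
    omega
  have hint : ∀ (a b : ℕ) (y : ℝ), 0 < y → y < 1 → (a : ℝ) ≠ b + 1 - y := by
    intro a b y hy0 hy1 h
    have h1 : (a : ℝ) < b + 1 := by linarith
    have h2 : (b : ℝ) < a := by linarith
    have h1' : a < b + 1 := by exact_mod_cast h1
    have h2' : b < a := by exact_mod_cast h2
    omega
  have hθ : Function.Injective θ := by
    rintro (l | ⟨i, j⟩) (l' | ⟨i', j'⟩) h <;> simp only [θ, Sum.elim_inl, Sum.elim_inr] at h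
    · exact congrArg Sum.inl (Fin.ext (by exact_mod_cast h))
    · exact (hint _ _ _ (hδ0 i') (hδ1 i') h).elim
    · exact (hint _ _ _ (hδ0 i) (hδ1 i) h.symm).elim
    · have hj : j = j' := Fin.ext (hnat _ _ _ _ (hδ0 i).le (hδ1 i) (hδ0 i').le (hδ1 i') h)
      subst hj
      rw [hδ (by linarith : δ i = δ i')]
  have hcsum : ∀ i, (∑ s ∈ Finset.univ.filter (fun s : T => o s = some i), (lam s - θ s)) =
      (Finset.univ.filter fun s : T => o s = some i).card * δ i := by
    intro i
    rw [← nsmul_eq_mul]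
    refine Finset.sum_eq_card_nsmul fun s hs => ?_
    obtain ⟨(l | ⟨i', j⟩), hsT⟩ := s
    · simp [o] at hs
    · have : i' = i := by simpa [o] using hs
      simp [lam, θ, this]
  obtain ⟨A, hA, hspec⟩ := exists_mem_symmetricMatrices_of_arrow (m := m) (J := T) (by simpa using hT)
    (fun s => o s) (fun s => lam s) (fun s => θ s) (hθ.comp Subtype.val_injective)
    (by
      rintro ⟨(l | p), hs⟩ h
      · rfl
      · simp [o] at h)
    (by
      rintro ⟨(l | ⟨i, j⟩), hs⟩ h
      · simp [o] at h
      · have h1 := hδ0 i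
        have h2 := hδ1 i
        simp only [θ, lam, Sum.elim_inr]
        constructor
        · have : (0 : ℝ) ≤ (j : ℕ) := by positivity
          linarith
        · linarith)
    (by
      rintro ⟨(l | ⟨i, j⟩), hs⟩ ⟨(l' | ⟨i', j'⟩), ht⟩ h1 h2 h3
      · simp [o] at h1
      · simp [o] at h1
      · simp [o] at h2
      · have hi : i = i' := by simpa [o] using h2
        subst hi
        have hj : (j : ℕ) ≠ j' := fun h => h3 (by simp [Fin.ext h])
        have e1 := hδ0 i
        have e2 := hδ1 i
        simp only [θ, lam, Sum.elim_inr]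
        rcases Nat.lt_or_ge j j' with h | h
        · have : ((j : ℕ) : ℝ) + 1 ≤ (j' : ℕ) := by exact_mod_cast h
          exact mul_pos_of_neg_of_neg (by linarith) (by linarith)
        · have : ((j' : ℕ) : ℝ) + 1 ≤ (j : ℕ) := by
            exact_mod_cast (lt_of_le_of_ne h hj.symm)
          exact mul_pos (by linarith) (by linarith))
    ⟨⟨_, hT₀⟩, by simp [o]⟩
    ⟨i₀, i₁, by
      rw [hcsum, hcsum]
      have h0 : 1 ≤ (Finset.univ.filter fun s : T => o s = some i₀).card :=
        Finset.card_pos.2 ⟨⟨_, hT₀⟩, by simp [o]⟩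
      have h1 : (Finset.univ.filter fun s : T => o s = some i₁).card ≤ d := by
        refine (Finset.card_le_card_of_injOn (fun s : T => (s : X))
          (t := Finset.univ.image fun j : Fin d => (Sum.inr (i₁, j) : X)) ?_
          Subtype.val_injective.injOn).trans (Finset.card_image_le.trans (by simp))
        rintro ⟨(l | ⟨i, j⟩), hs⟩ h
        · simp [o] at h
        · have : i = i₁ := by simpa [o] using h
          simp [this]
      have h0' : (1 : ℝ) ≤ (Finset.univ.filter fun s : T => o s = some i₀).card := by
        exact_mod_cast h0
      have h1' : ((Finset.univ.filter fun s : T => o s = some i₁).card : ℝ) ≤ d := by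
        exact_mod_cast h1
      have e0 : δ i₀ = 1 / 2 := by simp [δ, i₀]
      have e1 : δ i₁ = 1 / (2 * d + 4) := by simp [δ, i₁]; ring
      rw [e0, e1]
      refine ne_of_gt ?_
      calc _ ≤ (d : ℝ) * (1 / (2 * d + 4)) := by gcongr
        _ < 1 / 2 := by
          rw [mul_one_div, div_lt_div_iff₀ (by positivity) (by positivity)]
          linarith
        _ ≤ _ := by linarith⟩
  refine ⟨A, hA, ?_⟩
  have hsub : spectrum ℝ A ⊆
      (Finset.univ.image fun l : Fin (d + 1) => ((l : ℕ) : ℝ) : Finset ℝ) := by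
    intro z hz
    simp only [Finset.coe_image, Finset.coe_univ, Set.image_univ, Set.mem_range]
    rcases hspec z hz with rfl | ⟨⟨(l | ⟨i, j⟩), hs⟩, rfl⟩
    · exact ⟨0, by simp⟩
    · exact ⟨l, rfl⟩
    · exact ⟨j.succ, by simp [lam]⟩
  refine (Set.ncard_le_ncard hsub (Finset.finite_toSet _)).trans ?_
  rw [Set.ncard_coe_finset]
  exact Finset.card_image_le.trans (by simp)

theorem corollary2p5 (m n : ℕ) (hm : 2 ≤ m) (hn : 2 ≤ n) :
    (SimpleGraph.joinGraph (SimpleGraph.completeGraph (Fin n))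
        (SimpleGraph.pathGraph m)).minDistinctEigenvalues =
      ⌈((n : ℝ) + (m : ℝ)) / ((n : ℝ) + 1)⌉₊ := by
  have hn1 : (0 : ℝ) < n + 1 := by positivity
  obtain ⟨⟨A₀, hA₀, hq⟩, hmin⟩ := SimpleGraph.isLeast_minDistinctEigenvalues
    (SimpleGraph.joinGraph (SimpleGraph.completeGraph (Fin n)) (SimpleGraph.pathGraph m))
  apply le_antisymm
  -- As m ≥ 2, the ceiling is at least 2, which gives d ≥ 1.
  · have hk1 : 1 < ⌈((n : ℝ) + (m : ℝ)) / ((n : ℝ) + 1)⌉₊ := by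
      rw [Nat.lt_ceil, Nat.cast_one, one_lt_div hn1]
      have : (2 : ℝ) ≤ m := by exact_mod_cast hm
      linarith
    have hk2 := Nat.le_ceil (((n : ℝ) + (m : ℝ)) / ((n : ℝ) + 1))
    generalize ⌈((n : ℝ) + (m : ℝ)) / ((n : ℝ) + 1)⌉₊ = k at hk1 hk2 ⊢
    obtain ⟨d, rfl⟩ : ∃ d, k = d + 1 := ⟨k - 1, by omega⟩
    rw [div_le_iff₀ hn1] at hk2
    have hk3 : n + m ≤ (d + 1) * (n + 1) := by exact_mod_cast hk2
    obtain ⟨A, hA, hle⟩ := exists_numDistinctEigenvalues_join_path_le (m := m) (n := n) (d := d)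
      (by omega) hn (by omega) (by nlinarith)
    exact (hmin ⟨A, hA, rfl⟩).trans hle
  · rw [← hq, Nat.ceil_le, div_le_iff₀ hn1]
    have := card_le_numDistinctEigenvalues_mul hA₀ (by omega)
    rw [Fintype.card_fin] at this
    exact_mod_cast this
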